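/- For $n\ge 1$ and functions $f,g:\{0,1\}^n\to\mathbb{R}$ let $$\mathrm{Cor}_n(f,g):=\mathbb{P}\big(f(\xi_1,\dots,\xi_n)=g(\xi_1,\dots,\xi_n)\big)-\tfrac12,$$ where $\xi_1,\dots,\xi_n$ are independent random variables, each taking the values $0$ and $1$ with probability $\tfrac12$. Let $\mathrm{parity}:\{0,1\}^n\to\{0,1\}$ be the function that is $1$ at $x$ if $x_1+\dots+x_n$ is odd and $0$ otherwise. Theorem (Razborov–Viola). There is an $n_0$ such that for every $n\ge n_0$ and every real polynomial $p$ in $n$ variables of (total) degree at most $\tfrac12\log_2\log_2 n$, regarded as a function on $\{0,1\}^n$, $$\mathrm{Cor}_n(p,\mathrm{parity})\le 0 .$$ -/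

import Mathlib

/-- The law of a single fair bit: the uniform probability measure on `{0,1}`
(`false` is `0`, `true` is `1`). -/
noncomputable def fairBit : MeasureTheory.Measure Bool :=
  ProbabilityTheory.uniformOn Set.univ

/-- The joint law of `n` independent fair bits `(ξ₁, …, ξₙ)`. -/
noncomputable def fairBits (n : ℕ) : MeasureTheory.Measure (Fin n → Bool) :=
  MeasureTheory.Measure.pi fun _ => fairBit

/-- `Cor_n(f, g) = P(f(ξ) = g(ξ)) - 1/2` for independent fair bits `ξ = (ξ₁, …, ξₙ)`. -/
noncomputable def cor (n : ℕ) (f g : (Fin n → Bool) → ℝ) : ℝ :=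
  (fairBits n).real {x | f x = g x} - 1 / 2

/-- The point of `ℝⁿ` with the given `0`/`1` coordinates. -/
def cubePoint {n : ℕ} (x : Fin n → Bool) : Fin n → ℝ :=
  fun i => if x i then 1 else 0

/-- The parity function: `1` if the number of ones is odd, and `0` otherwise. -/
noncomputable def parity (n : ℕ) (x : Fin n → Bool) : ℝ :=
  if Odd (Finset.univ.filter fun i => x i = true).card then 1 else 0

/-- The function on `{0,1}ⁿ` given by a real polynomial in `n` variables. -/
noncomputable def polyOnCube {n : ℕ} (p : MvPolynomial (Fin n) ℝ) (x : Fin n → Bool) : ℝ :=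
  MvPolynomial.eval (cubePoint x) p

instance : MeasureTheory.IsProbabilityMeasure fairBit := by
  unfold fairBit; infer_instance

instance (n : ℕ) : MeasureTheory.IsProbabilityMeasure (fairBits n) := by
  unfold fairBits; infer_instance

theorem fairBit_singleton (b : Bool) : fairBit {b} = 2⁻¹ := by
  rw [fairBit, ProbabilityTheory.uniformOn_univ]
  simp

/-- Every point of the cube has probability `2⁻ⁿ`. -/
theorem fairBits_singleton (n : ℕ) (x : Fin n → Bool) : (fairBits n) {x} = 2⁻¹ ^ n := by
  simp [fairBits, MeasureTheory.Measure.pi_singleton, fairBit_singleton]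

/-- The correlation as a count of points of agreement. -/
theorem cor_eq_card (n : ℕ) (f g : (Fin n → Bool) → ℝ) :
    cor n f g = ((Finset.univ.filter fun x => f x = g x).card : ℝ) / 2 ^ n - 1 / 2 := by
  have h : ({x | f x = g x} : Set (Fin n → Bool)) =
      ((Finset.univ.filter fun x => f x = g x : Finset (Fin n → Bool)) : Set _) := by
    ext x; simp
  rw [cor, h, ← MeasureTheory.sum_measureReal_singleton]
  simp [MeasureTheory.measureReal_def, fairBits_singleton, div_eq_mul_inv]

/-! The core is a dichotomy for a polynomial `p` of degree `d` on the cube. Take a maximal family of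
pairwise disjoint degree-`d` monomials with nonzero coefficient.

If the family is large, `p` is anti-concentrated (`card_cubeSum_eq_zero_le`): it takes each of the
values 0 and 1 on at most a quarter of the cube, so it meets parity on at most half. If the family
is small, so is the set of its variables, and by maximality every monomial of degree `d` meets that
set. Fixing these variables in any way lowers the degree and turns parity into parity or its
negation, so induction applies. A constant agrees with parity on exactly half of the cube or
nowhere, as long as one variable is left.

Anti-concentration is proved by induction on the degree. Pick one variable from each monomial of the
family and let `z` collect them. By Cauchy–Schwarz, the squared probability of `p(x,z) = 0` is at
most that of `p(x,z) - p(x,z') = 0`. In `x` this difference has smaller degree, and its top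
coefficients are affine in `z`. Many of them are nonzero for most `z`
(`two_pow_mul_card_few_nonzero_le`): forms with many entries are handled by Littlewood–Offord, and
among sparse forms there is a large subfamily in which each form has a private variable, to which
Chebyshev applies. -/

/-! ### The Littlewood–Offord bound -/

open Finset in
/-- Erdős's solution of the Littlewood–Offord problem. -/
theorem card_sum_eq_le_choose {α : Type*} [Fintype α] [DecidableEq α] (a : α → ℝ)
    (ha : ∀ i, a i ≠ 0) (c : ℝ) :
    #{z : Finset α | ∑ i ∈ z, a i = c} ≤ (Fintype.card α).choose (Fintype.card α / 2) := by
  classical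
  set N : Finset α := univ.filter fun i => a i < 0 with hN
  -- Flipping the coordinates in `N` makes all coefficients positive; the solutions then form an
  -- antichain and Sperner's theorem applies.
  have key (z : Finset α) : ∑ i ∈ symmDiff z N, |a i| = ∑ i ∈ z, a i - ∑ i ∈ N, a i := by
    have hu (s : Finset α) (g : α → ℝ) : ∑ i ∈ s, g i = ∑ i, if i ∈ s then g i else 0 := by simp
    rw [hu z, hu N, hu (symmDiff z N), ← Finset.sum_sub_distrib]
    refine sum_congr rfl fun i _ => ?_
    rcases lt_or_gt_of_ne (ha i) with h | h
    · by_cases hz : i ∈ z <;> simp [mem_symmDiff, hz, hN, h, abs_of_neg h]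
    · by_cases hz : i ∈ z <;> simp [mem_symmDiff, hz, hN, abs_of_pos h, not_lt.2 h.le]
  rw [← card_image_of_injective _ (symmDiff_left_injective N)]
  apply IsAntichain.sperner
  intro s hs t ht hst hsub
  simp only [coe_image, coe_filter, mem_univ, true_and, Set.mem_image, Set.mem_ofPred_eq] at hs ht
  obtain ⟨s, hs, rfl⟩ := hs
  obtain ⟨t, ht, rfl⟩ := ht
  obtain ⟨i, hit, his⟩ := exists_of_ssubset (lt_of_le_of_ne hsub hst)
  have h := sum_lt_sum_of_subset hsub hit his (f := fun i => |a i|) (abs_pos.2 (ha i))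
    fun _ _ _ => abs_nonneg _
  rw [key, key, hs, ht] at h
  exact lt_irrefl _ h

/-- The bound `4 ^ n / √(2 * n + 1)`, squared to stay in `ℕ`. The induction closes because
`(2n+1)(2n+3) ≤ (2n+2)²`. -/
theorem centralBinom_sq_mul_le (n : ℕ) : n.centralBinom ^ 2 * (2 * n + 1) ≤ 16 ^ n := by
  induction n with
  | zero => simp
  | succ n ih =>
    have h := Nat.succ_mul_centralBinom_succ n
    refine Nat.le_of_mul_le_mul_left ?_ (show 0 < (n + 1) ^ 2 by positivity)
    calc (n + 1) ^ 2 * ((n + 1).centralBinom ^ 2 * (2 * (n + 1) + 1))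
        = ((n + 1) * (n + 1).centralBinom) ^ 2 * (2 * n + 3) := by ring
      _ = n.centralBinom ^ 2 * (2 * n + 1) * (4 * (2 * n + 1) * (2 * n + 3)) := by rw [h]; ring
      _ ≤ 16 ^ n * (4 * (2 * n + 1) * (2 * n + 3)) := Nat.mul_le_mul_right _ ih
      _ ≤ 16 ^ n * (16 * (n + 1) ^ 2) := Nat.mul_le_mul_left _ (by nlinarith)
      _ = (n + 1) ^ 2 * 16 ^ (n + 1) := by ring

/-- With `4 ^ u` variables the saving, the square root of their number, is the integer `2 ^ u`. -/
theorem two_pow_mul_choose_half_le {u : ℕ} (hu : 1 ≤ u) :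
    2 ^ u * (4 ^ u).choose (4 ^ u / 2) ≤ 2 ^ 4 ^ u := by
  obtain ⟨v, rfl⟩ := Nat.exists_eq_add_of_le' hu
  set m := 2 * 4 ^ v with hm
  have h4 : 4 ^ (v + 1) = 2 * m := by rw [hm]; ring
  have h := centralBinom_sq_mul_le m
  rw [Nat.centralBinom_eq_two_mul_choose] at h
  rw [h4, Nat.mul_div_cancel_left _ two_pos]
  refine (Nat.pow_le_pow_iff_left two_ne_zero).1 ?_
  calc (2 ^ (v + 1) * (2 * m).choose m) ^ 2
      = (2 * m).choose m ^ 2 * (2 * m) := by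
        rw [← h4, mul_pow, ← pow_mul, mul_comm (v + 1) 2, pow_mul]; norm_num; ring
    _ ≤ (2 * m).choose m ^ 2 * (2 * m + 1) := Nat.mul_le_mul_left _ (Nat.le_succ _)
    _ ≤ 16 ^ m := h
    _ = (2 ^ (2 * m)) ^ 2 := by
        rw [← pow_mul, show (16 : ℕ) = 2 ^ 4 by norm_num, ← pow_mul]
        congr 1
        ring

/-! ### Splitting the cube into two blocks of variables -/

theorem sum_powerset_disjUnion {V M : Type*} [DecidableEq V] [AddCommMonoid M] {X Z : Finset V}
    (h : Disjoint X Z) (F : Finset V → M) :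
    ∑ w ∈ (X ∪ Z).powerset, F w = ∑ x ∈ X.powerset, ∑ z ∈ Z.powerset, F (x ∪ z) := by
  rw [← Finset.sum_product']
  symm
  refine Finset.sum_nbij' (fun p => p.1 ∪ p.2) (fun w => (w ∩ X, w ∩ Z)) ?_ ?_ ?_ ?_ ?_
  · simp only [Finset.mem_product, Finset.mem_powerset]
    exact fun p hp => Finset.union_subset_union hp.1 hp.2
  · simp only [Finset.mem_product, Finset.mem_powerset]
    exact fun w _ => ⟨Finset.inter_subset_right, Finset.inter_subset_right⟩
  · rintro ⟨x, z⟩ hp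
    simp only [Finset.mem_product, Finset.mem_powerset] at hp
    rw [Finset.disjoint_left] at h
    ext i <;> have := @hp.1 i <;> have := @hp.2 i <;> have := @h i <;> simp <;> tauto
  · intro w hw
    rw [Finset.mem_powerset] at hw
    change w ∩ X ∪ w ∩ Z = w
    rw [← Finset.inter_union_distrib_left, Finset.inter_eq_left.2 hw]
  · exact fun _ _ => rfl

theorem card_filter_powerset_disjUnion {V : Type*} [DecidableEq V] {X Z : Finset V}
    (h : Disjoint X Z) (P : Finset V → Prop) [DecidablePred P] :
    ((X ∪ Z).powerset.filter P).card =
      ∑ x ∈ X.powerset, (Z.powerset.filter fun z => P (x ∪ z)).card := by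
  simp only [Finset.card_filter]
  exact sum_powerset_disjUnion h _

open Finset in
-- Fix the coordinates outside `H` and apply Littlewood–Offord to those in `H`.
theorem two_pow_mul_card_sum_eq_le {V : Type*} [DecidableEq V] {Z H : Finset V} (hHZ : H ⊆ Z)
    {a : V → ℝ} (ha : ∀ i ∈ H, a i ≠ 0) (c : ℝ) {u : ℕ} (hu : 1 ≤ u) (hH : H.card = 4 ^ u) :
    2 ^ u * #{z ∈ Z.powerset | ∑ i ∈ z, a i = c} ≤ 2 ^ #Z := by
  have key (c : ℝ) : #{z ∈ H.powerset | ∑ i ∈ z, a i = c} ≤ (4 ^ u).choose (4 ^ u / 2) := by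
    have := card_sum_eq_le_choose (fun i : H => a i) (fun i => ha i i.2) c
    rw [Fintype.card_coe, hH] at this
    refine le_trans ?_ this
    refine card_le_card_of_injOn (fun z => z.subtype (· ∈ H)) ?_ ?_
    · intro z hz
      simp only [coe_filter, mem_powerset, Set.mem_ofPred_eq, mem_univ, true_and] at hz ⊢
      rw [← hz.2]
      exact sum_subtype_of_mem a fun x hx => hz.1 hx
    · intro z hz z' hz' h
      simp only [coe_filter, mem_powerset, Set.mem_ofPred_eq] at hz hz'
      rw [← subtype_map_of_mem (s := z) (p := (· ∈ H)) fun x hx => hz.1 hx,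
        ← subtype_map_of_mem (s := z') (p := (· ∈ H)) fun x hx => hz'.1 hx]
      exact congrArg _ h
  have hZ : Z = Z \ H ∪ H := (sdiff_union_of_subset hHZ).symm
  have hcard : #Z = #(Z \ H) + 4 ^ u := by rw [← hH, card_sdiff_add_card_eq_card hHZ]
  rw [hcard, pow_add, hZ, card_filter_powerset_disjUnion sdiff_disjoint, mul_sum, ← card_powerset,
    ← smul_eq_mul (#(powerset _)), union_sdiff_right, Finset.sdiff_idem]
  refine sum_le_card_nsmul _ _ _ fun x hx => ?_
  refine le_trans (Nat.mul_le_mul_left _ ?_) (two_pow_mul_choose_half_le hu)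
  refine le_trans (card_le_card fun z hz => ?_) (key (c - ∑ i ∈ x, a i))
  simp only [mem_filter, mem_powerset] at hz hx ⊢
  refine ⟨hz.1, ?_⟩
  rw [← hz.2, sum_union (disjoint_of_subset_left hx (disjoint_of_subset_right hz.1 sdiff_disjoint))]
  ring

/-! ### Systems of linear forms -/

theorem sum_powerset_two_mul_card_sub_sq {V : Type*} [DecidableEq V] (J : Finset V) :
    ∑ w ∈ J.powerset, (2 * (w.card : ℤ) - J.card) ^ 2 = (J.card : ℤ) * 2 ^ J.card := by
  induction J using Finset.induction_on with
  | empty => simp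
  | insert b J hb ih =>
    rw [Finset.sum_powerset_insert hb, ← Finset.sum_add_distrib, Finset.card_insert_of_notMem hb]
    have : ∀ w ∈ J.powerset, (2 * (w.card : ℤ) - (J.card + 1 : ℕ)) ^ 2
        + (2 * ((insert b w).card : ℤ) - (J.card + 1 : ℕ)) ^ 2
        = 2 * (2 * (w.card : ℤ) - J.card) ^ 2 + 2 := by
      intro w hw
      rw [Finset.card_insert_of_notMem fun h => hb (Finset.mem_powerset.1 hw h)]
      push_cast
      ring
    rw [Finset.sum_congr rfl this, Finset.sum_add_distrib, ← Finset.mul_sum, ih]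
    simp
    ring

open Finset in
-- Chebyshev's inequality, from the second moment above.
theorem card_mul_card_filter_small_le {V : Type*} [DecidableEq V] (J : Finset V) :
    #J * #{w ∈ J.powerset | 4 * #w < #J} ≤ 4 * 2 ^ #J := by
  have h1 : ∑ w ∈ J.powerset with 4 * #w < #J, (#J : ℤ) ^ 2
      ≤ ∑ w ∈ J.powerset, 4 * (2 * (#w : ℤ) - #J) ^ 2 := by
    refine le_trans (sum_le_sum fun w hw => ?_)
      (sum_le_sum_of_subset_of_nonneg (filter_subset _ _) fun _ _ _ => by positivity)
    have : (4 * #w : ℤ) < #J := mod_cast (mem_filter.1 hw).2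
    nlinarith
  rw [← mul_sum, sum_powerset_two_mul_card_sub_sq, sum_const, nsmul_eq_mul] at h1
  rcases Nat.eq_zero_or_pos #J with h | h
  · simp [h]
  have h2 : #{w ∈ J.powerset | 4 * #w < #J} * #J ^ 2 ≤ 4 * (#J * 2 ^ #J) := mod_cast h1
  refine Nat.le_of_mul_le_mul_left ?_ h
  linarith

open Finset in
/-- A digraph of out-degree at most `k` has an independent set of density `1 / (2 * k + 1)`. -/
theorem exists_independent_of_card_out_le {ι : Type*} [DecidableEq ι] (R : ι → ι → Prop)
    [DecidableRel R] (k : ℕ) (S : Finset ι) (hS : ∀ s ∈ S, #{t ∈ S | R s t} ≤ k) :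
    ∃ T ⊆ S, (∀ s ∈ T, ∀ t ∈ T, s ≠ t → ¬ R s t) ∧ #S ≤ (2 * k + 1) * #T := by
  induction S using Finset.strongInduction with
  | H S ih =>
  rcases S.eq_empty_or_nonempty with rfl | hne
  · exact ⟨∅, by simp⟩
  -- The average in-degree equals the average out-degree, so some vertex has in-degree at most `k`;
  -- keep it and delete its neighbours.
  obtain ⟨v, hv, hvk⟩ : ∃ v ∈ S, #{s ∈ S | R s v} ≤ k := by
    by_contra! h
    have h1 := sum_lt_sum_of_nonempty hne h
    have h2 := sum_le_sum hS
    have h3 := sum_card_bipartiteAbove_eq_sum_card_bipartiteBelow (s := S) (t := S) R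
    simp only [bipartiteAbove, bipartiteBelow] at h3
    omega
  set D := insert v ({s ∈ S | R s v} ∪ {t ∈ S | R v t}) with hD
  have hDS : D ⊆ S := by
    rw [hD, insert_subset_iff]
    exact ⟨hv, union_subset (filter_subset _ _) (filter_subset _ _)⟩
  have hDc : #D ≤ 2 * k + 1 := by
    refine (card_insert_le _ _).trans ?_
    have := card_union_le {s ∈ S | R s v} {t ∈ S | R v t}
    have := hS v hv
    omega
  have hvD : v ∈ D := mem_insert_self _ _
  obtain ⟨T, hTS, hT, hTc⟩ := ih (S \ D)
    ((ssubset_iff_of_subset sdiff_subset).2 ⟨v, hv, by simp [hvD]⟩)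
    fun s hs => le_trans (card_le_card (filter_subset_filter _ sdiff_subset))
      (hS s (sdiff_subset hs))
  have hn (t) (ht : t ∈ T) : t ∈ S ∧ ¬ R t v ∧ ¬ R v t := by
    have := hTS ht
    simp only [hD, mem_sdiff, mem_insert, mem_union, mem_filter] at this
    tauto
  have hvT : v ∉ T := fun h => (mem_sdiff.1 (hTS h)).2 hvD
  refine ⟨insert v T, insert_subset hv (hTS.trans sdiff_subset), ?_, ?_⟩
  · intro s hs t ht hst
    rcases mem_insert.1 hs with hsv | hsT <;> rcases mem_insert.1 ht with htv | htT
    · exact absurd (hsv.trans htv.symm) hst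
    · exact hsv ▸ (hn t htT).2.2
    · exact htv ▸ (hn s hsT).2.1
    · exact hT s hsT t htT hst
  · rw [card_insert_of_notMem hvT, ← card_sdiff_add_card_eq_card hDS]
    linarith

open Finset in
-- Once the variables outside the image of `j` are fixed, form `t` depends only on its private
-- variable `j t`, so the forms behave like independent bits and Chebyshev applies.
theorem card_mul_card_few_nonzero_le_of_independent {ι V : Type*} [DecidableEq V]
    {T : Finset ι} {Z : Finset V} {j : ι → V} (hj : Set.InjOn j T) (hjZ : ∀ t ∈ T, j t ∈ Z)
    {a : ι → V → ℝ} (ha : ∀ t ∈ T, a t (j t) ≠ 0)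
    (hind : ∀ s ∈ T, ∀ t ∈ T, s ≠ t → a s (j t) = 0) (c : ι → ℝ) :
    #T * #{z ∈ Z.powerset | 4 * #{t ∈ T | ∑ i ∈ z, a t i ≠ c t} < #T} ≤ 4 * 2 ^ #Z := by
  classical
  set J := T.image j with hJ
  have hJZ : J ⊆ Z := image_subset_iff.2 hjZ
  have hJc : #J = #T := card_image_of_injOn hj
  have hZ : Z = Z \ J ∪ J := (sdiff_union_of_subset hJZ).symm
  have hcard : #Z = #(Z \ J) + #J := (card_sdiff_add_card_eq_card hJZ).symm
  rw [hcard, pow_add, hZ, card_filter_powerset_disjUnion sdiff_disjoint,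
    union_sdiff_right, Finset.sdiff_idem, mul_sum, mul_left_comm, ← card_powerset (Z \ J),
    ← smul_eq_mul (#(powerset _))]
  refine sum_le_card_nsmul _ _ _ fun y hy => ?_
  rw [mem_powerset] at hy
  rw [← hJc]
  refine le_trans (Nat.mul_le_mul_left _ ?_) (card_mul_card_filter_small_le J)
  -- Form `t` avoids `c t` whenever `j t ∈ symmDiff v B`, and `v ↦ symmDiff v B` is injective.
  set B := {t ∈ T | ∑ i ∈ y, a t i ≠ c t}.image j with hB
  have hBJ : B ⊆ J := image_subset_image (filter_subset _ _)
  have hjB (t) (ht : t ∈ T) : j t ∈ B ↔ ∑ i ∈ y, a t i ≠ c t := by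
    simp only [hB, mem_image, mem_filter]
    exact ⟨fun ⟨s, hs, hst⟩ => hj hs.1 ht hst ▸ hs.2, fun h => ⟨t, ⟨ht, h⟩, rfl⟩⟩
  have hsum (t) (ht : t ∈ T) (v) (hv : v ⊆ J) :
      ∑ i ∈ y ∪ v, a t i = ∑ i ∈ y, a t i + if j t ∈ v then a t (j t) else 0 := by
    rw [sum_union (disjoint_of_subset_left hy (disjoint_of_subset_right hv sdiff_disjoint))]
    congr 1
    rw [← sum_ite_eq' v (j t) (a t)]
    refine sum_congr rfl fun i hi => ?_
    split_ifs with h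
    · rfl
    · obtain ⟨s, hs, rfl⟩ := mem_image.1 (hv hi)
      exact hind t ht s hs fun e => h (by rw [e])
  refine card_le_card_of_injOn (fun v => symmDiff v B) ?_ (symmDiff_left_injective B).injOn
  intro v hv
  simp only [coe_filter, mem_powerset, Set.mem_ofPred_eq] at hv ⊢
  have hvB : symmDiff v B ⊆ J := by
    rw [symmDiff_def]
    exact union_subset (sdiff_subset.trans hv.1) (sdiff_subset.trans hBJ)
  refine ⟨hvB, lt_of_le_of_lt (Nat.mul_le_mul_left _ ?_) hv.2⟩
  refine le_trans (card_le_card (t := image j {t ∈ T | ∑ i ∈ y ∪ v, a t i ≠ c t}) ?_)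
    card_image_le
  intro i hi
  obtain ⟨t, ht, rfl⟩ := mem_image.1 (hvB hi)
  refine mem_image_of_mem _ (mem_filter.2 ⟨ht, fun h => ?_⟩)
  rw [hsum t ht v hv.1] at h
  rw [mem_symmDiff, hjB t ht] at hi
  have hat := ha t ht
  by_cases htv : j t ∈ v
  · rw [if_pos htv] at h
    have h0 : ∑ i ∈ y, a t i = c t := by tauto
    exact hat (by linarith)
  · rw [if_neg htv, add_zero] at h
    tauto

open Finset in
-- Markov's inequality: each form hits its value with probability at most `2⁻ᵘ`, while a bad point
-- makes at least half of the forms do so.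
theorem two_pow_mul_card_few_nonzero_le_of_dense {ι V : Type*} [DecidableEq V]
    {T : Finset ι} {Z : Finset V} {a : ι → V → ℝ} {u r : ℕ} (hu : 1 ≤ u)
    (ha : ∀ t ∈ T, 4 ^ u ≤ #{i ∈ Z | a t i ≠ 0}) (c : ι → ℝ) (hT : 0 < #T) (hr : 2 * r ≤ #T) :
    2 ^ u * #{z ∈ Z.powerset | #{t ∈ T | ∑ i ∈ z, a t i ≠ c t} < r} ≤ 2 * 2 ^ #Z := by
  classical
  set B := {z ∈ Z.powerset | #{t ∈ T | ∑ i ∈ z, a t i ≠ c t} < r} with hB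
  have h1 (t) (ht : t ∈ T) : 2 ^ u * #{z ∈ Z.powerset | ∑ i ∈ z, a t i = c t} ≤ 2 ^ #Z := by
    obtain ⟨H, hH, hHc⟩ := exists_subset_card_eq (ha t ht)
    exact two_pow_mul_card_sum_eq_le (hH.trans (filter_subset _ _))
      (fun i hi => (mem_filter.1 (hH hi)).2) _ hu hHc
  have h2 := sum_card_bipartiteAbove_eq_sum_card_bipartiteBelow (s := T) (t := Z.powerset)
    fun t z => ∑ i ∈ z, a t i = c t
  simp only [bipartiteAbove, bipartiteBelow] at h2
  have h3 : #B * #T ≤ ∑ z ∈ Z.powerset, 2 * #{t ∈ T | ∑ i ∈ z, a t i = c t} := by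
    have hBZ : B ⊆ Z.powerset := filter_subset _ _
    refine le_trans ?_ (sum_le_sum_of_subset hBZ)
    rw [← smul_eq_mul]
    refine card_nsmul_le_sum _ _ _ fun z hz => ?_
    have := (mem_filter.1 hz).2
    have := card_filter_add_card_filter_not (s := T) fun t => ∑ i ∈ z, a t i = c t
    simp only [ne_eq] at *
    omega
  have h4 := sum_le_card_nsmul T _ _ h1
  rw [← mul_sum, h2, smul_eq_mul] at h4
  rw [← mul_sum] at h3
  refine Nat.le_of_mul_le_mul_left ?_ hT
  nlinarith [Nat.mul_le_mul_left (2 ^ u) h3]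

open Finset in
/-- Linear forms with a nonzero entry each, in distinct columns: few of them avoid their prescribed
values only for a small proportion of the points of the cube. -/
theorem two_pow_mul_card_few_nonzero_le {ι V : Type*} [DecidableEq V]
    {T : Finset ι} {Z : Finset V} {j : ι → V} (hj : Set.InjOn j T) (hjZ : ∀ t ∈ T, j t ∈ Z)
    {a : ι → V → ℝ} (ha : ∀ t ∈ T, a t (j t) ≠ 0) (c : ι → ℝ) {u r : ℕ} (hu : 1 ≤ u)
    (hr : 2 ^ u ≤ r) (hT : 32 * 4 ^ u * r ≤ #T) :
    2 ^ u * #{z ∈ Z.powerset | #{t ∈ T | ∑ i ∈ z, a t i ≠ c t} < r} ≤ 2 * 2 ^ #Z := by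
  classical
  have h4 : 1 ≤ 4 ^ u := Nat.one_le_pow _ _ (by norm_num)
  have hr0 : 0 < r := lt_of_lt_of_le (by positivity) hr
  have hmono {T' : Finset ι} (h : T' ⊆ T) :
      #{z ∈ Z.powerset | #{t ∈ T | ∑ i ∈ z, a t i ≠ c t} < r} ≤
        #{z ∈ Z.powerset | #{t ∈ T' | ∑ i ∈ z, a t i ≠ c t} < r} :=
    card_le_card fun z hz => mem_filter.2 ⟨(mem_filter.1 hz).1,
      lt_of_le_of_lt (card_le_card (filter_subset_filter _ h)) (mem_filter.1 hz).2⟩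
  have hsplit := card_filter_add_card_filter_not (s := T) fun t => 4 ^ u ≤ #{i ∈ Z | a t i ≠ 0}
  set Td := {t ∈ T | 4 ^ u ≤ #{i ∈ Z | a t i ≠ 0}} with hTd
  set Ts := {t ∈ T | ¬ 4 ^ u ≤ #{i ∈ Z | a t i ≠ 0}} with hTs
  by_cases hd : 16 * 4 ^ u * r ≤ #Td
  · have h6 : 16 * r ≤ #Td := le_trans (by nlinarith) hd
    exact (Nat.mul_le_mul_left _ (hmono (filter_subset _ _))).trans
      (two_pow_mul_card_few_nonzero_le_of_dense hu (fun t ht => (mem_filter.1 ht).2) c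
        (lt_of_lt_of_le (by omega) h6) (le_trans (by omega) h6))
  · have hs : 16 * 4 ^ u * r ≤ #Ts := by linarith
    have hsub : Ts ⊆ T := filter_subset _ _
    -- An edge from `s` to `t` means that form `s` involves the variable of `t`; sparsity bounds the
    -- out-degree.
    obtain ⟨I, hI, hind, hIc⟩ := exists_independent_of_card_out_le (fun s t => a s (j t) ≠ 0)
      (4 ^ u) Ts fun s hs => by
        refine le_trans ?_ (not_le.1 (mem_filter.1 hs).2).le
        refine card_le_card_of_injOn j ?_ (hj.mono ?_)
        · intro t ht
          have ht := mem_filter.1 (mem_coe.1 ht)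
          exact mem_coe.2 (mem_filter.2 ⟨hjZ t (hsub ht.1), ht.2⟩)
        · intro t ht
          exact hsub (mem_filter.1 (mem_coe.1 ht)).1
    have hIT := hI.trans hsub
    have hI4 : 4 * r ≤ #I := by
      have : 16 * 4 ^ u * r ≤ 4 ^ u * (3 * #I) := by nlinarith
      have : 16 * r ≤ 3 * #I := Nat.le_of_mul_le_mul_left (by linarith) (show 0 < 4 ^ u by omega)
      omega
    have h7 := card_mul_card_few_nonzero_le_of_independent (hj.mono (coe_subset.2 hIT))
      (fun t ht => hjZ t (hIT ht)) (fun t ht => ha t (hIT ht))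
      (fun s hs t ht hst => not_not.1 (hind s hs t ht hst)) c
    have h8 : #{z ∈ Z.powerset | #{t ∈ I | ∑ i ∈ z, a t i ≠ c t} < r} ≤
        #{z ∈ Z.powerset | 4 * #{t ∈ I | ∑ i ∈ z, a t i ≠ c t} < #I} :=
      card_le_card fun z hz => mem_filter.2 ⟨(mem_filter.1 hz).1, by
        have := (mem_filter.1 hz).2
        omega⟩
    have h9 := (hmono hIT).trans h8
    nlinarith [Nat.mul_le_mul (hr.trans (by omega : r ≤ #I)) h9,
      Nat.mul_le_mul (by omega : 4 * 2 ^ u ≤ #I) h9]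

/-! ### Multilinear polynomials and anti-concentration -/

/-- The value at `x ⊆ V`, as a point of the cube, of the multilinear polynomial with the
coefficients `a`. -/
def cubeSum {V : Type*} (a : Finset V → ℝ) (x : Finset V) : ℝ :=
  ∑ S ∈ x.powerset, a S

/-- The coefficients of a multilinear polynomial after the variables in `z` are set to `1`. -/
def setOnes {V : Type*} [DecidableEq V] (a : Finset V → ℝ) (z S : Finset V) : ℝ :=
  ∑ B ∈ z.powerset, a (S ∪ B)

theorem cubeSum_union {V : Type*} [DecidableEq V] (a : Finset V → ℝ) {x z : Finset V}
    (h : Disjoint x z) : cubeSum a (x ∪ z) = cubeSum (setOnes a z) x :=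
  sum_powerset_disjUnion h a

theorem cubeSum_sub {V : Type*} (a b : Finset V → ℝ) (x : Finset V) :
    cubeSum (a - b) x = cubeSum a x - cubeSum b x :=
  Finset.sum_sub_distrib _ _

theorem setOnes_eq_add_sum {V : Type*} [DecidableEq V] {a : Finset V → ℝ} {z S : Finset V}
    (h : ∀ B ⊆ z, 1 < B.card → a (S ∪ B) = 0) :
    setOnes a z S = a S + ∑ i ∈ z, a (insert i S) := by
  have hsub : insert ∅ (z.image singleton) ⊆ z.powerset := by
    intro B hB
    simp only [Finset.mem_insert, Finset.mem_image] at hB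
    rcases hB with rfl | ⟨i, hi, rfl⟩ <;> simp [*]
  rw [setOnes, ← Finset.sum_subset hsub, Finset.sum_insert (by simp), Finset.sum_image (by simp)]
  · rw [Finset.union_empty]
    simp only [Finset.insert_eq, Finset.union_comm S]
  · intro B hB hB'
    refine h B (Finset.mem_powerset.1 hB) ?_
    by_contra hc
    rcases Nat.le_one_iff_eq_zero_or_eq_one.1 (not_lt.1 hc) with h0 | h1
    · simp [Finset.card_eq_zero.1 h0] at hB'
    · obtain ⟨i, rfl⟩ := Finset.card_eq_one.1 h1
      simp at hB hB'
      tauto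

open Finset in
-- Cauchy–Schwarz over `x`, then: if both copies `z` and `z'` give a zero, so does their difference.
theorem sq_card_cubeSum_eq_zero_le {V : Type*} [DecidableEq V] (a : Finset V → ℝ)
    {X Z : Finset V} (h : Disjoint X Z) :
    #{w ∈ (X ∪ Z).powerset | cubeSum a w = 0} ^ 2 ≤ 2 ^ #X * ∑ z' ∈ Z.powerset,
      ∑ z ∈ Z.powerset, #{x ∈ X.powerset | cubeSum (setOnes a z - setOnes a z') x = 0} := by
  rw [card_filter_powerset_disjUnion h, ← card_powerset]
  refine sq_sum_le_card_mul_sum_sq.trans (Nat.mul_le_mul_left _ ?_)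
  have h1 (x) : #{z ∈ Z.powerset | cubeSum a (x ∪ z) = 0} ^ 2 =
      ∑ z' ∈ Z.powerset, ∑ z ∈ Z.powerset,
        if cubeSum a (x ∪ z) = 0 ∧ cubeSum a (x ∪ z') = 0 then 1 else 0 := by
    rw [sq, card_filter, sum_mul_sum, sum_comm]
    simp only [ite_and, mul_ite, mul_one, mul_zero]
    refine sum_congr rfl fun _ _ => sum_congr rfl fun _ _ => ?_
    split_ifs <;> rfl
  simp only [h1]
  rw [sum_comm]
  refine sum_le_sum fun z' hz' => ?_
  rw [sum_comm]
  refine sum_le_sum fun z hz => ?_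
  rw [← card_filter]
  refine card_le_card fun x hx => ?_
  rw [mem_filter] at hx ⊢
  rw [mem_powerset] at hz hz'
  have hxX := mem_powerset.1 hx.1
  refine ⟨hx.1, ?_⟩
  rw [cubeSum_sub, ← cubeSum_union a (disjoint_of_subset_left hxX (disjoint_of_subset_right hz h)),
    ← cubeSum_union a (disjoint_of_subset_left hxX (disjoint_of_subset_right hz' h)), hx.2.1,
    hx.2.2, sub_zero]

open Finset in
/-- Anti-concentration: a polynomial of degree `d` with many disjoint monomials of degree `d`
vanishes on a small proportion of the cube. -/
theorem card_cubeSum_eq_zero_le {ι V : Type*} [DecidableEq V] {u : ℕ} (hu : 1 ≤ u) (d : ℕ)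
    {X : Finset V} {a : Finset V → ℝ} (hdeg : ∀ S ⊆ X, d < #S → a S = 0) {T : Finset ι}
    {e : ι → Finset V} (heX : ∀ t ∈ T, e t ⊆ X) (hec : ∀ t ∈ T, #(e t) = d)
    (hdisj : (T : Set ι).PairwiseDisjoint e) (hea : ∀ t ∈ T, a (e t) ≠ 0)
    (hT : (32 * 4 ^ u) ^ d * 2 ^ u ≤ #T) {q : ℝ} (hq0 : 0 ≤ q) (hq1 : q ≤ 1)
    (hq : 2 / 2 ^ u ≤ q ^ 2 ^ d) :
    (#{x ∈ X.powerset | cubeSum a x = 0} : ℝ) ≤ 2 * q * 2 ^ #X := by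
  classical
  have hTpos : 0 < #T := lt_of_lt_of_le (by positivity) hT
  obtain ⟨t₀, ht₀⟩ := card_pos.1 hTpos
  induction d generalizing X a T e q t₀ with
  | zero =>
    rw [filter_false_of_mem, card_empty, Nat.cast_zero]
    · positivity
    intro x hx
    rw [cubeSum, sum_eq_single ∅]
    · simpa [card_eq_zero.1 (hec t₀ ht₀)] using hea t₀ ht₀
    · intro S hS hS0
      exact hdeg S ((mem_powerset.1 hS).trans (mem_powerset.1 hx))
        (card_pos.2 (nonempty_iff_ne_empty.2 hS0))
    · simp
  | succ d ih =>
    have hne (t) (ht : t ∈ T) : ∃ v, v ∈ e t := card_pos.1 (by rw [hec t ht]; omega)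
    have : Nonempty V := ⟨(hne t₀ ht₀).choose⟩
    choose! j hj using hne
    have hjinj : Set.InjOn j T := fun s hs t ht hst => by
      by_contra h
      exact disjoint_left.1 (hdisj hs ht h) (hj s hs) (hst ▸ hj t ht)
    set Z := T.image j with hZ
    have hjZ (t) (ht : t ∈ T) : j t ∈ Z := mem_image_of_mem j ht
    have hZX : Z ⊆ X := image_subset_iff.2 fun t ht => heX t ht (hj t ht)
    have hXZ : X = X \ Z ∪ Z := (sdiff_union_of_subset hZX).symm
    have hcard : #X = #(X \ Z) + #Z := (card_sdiff_add_card_eq_card hZX).symm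
    have he (t) (ht : t ∈ T) : insert (j t) (e t \ Z) = e t := by
      ext v
      rw [mem_insert, mem_sdiff]
      refine ⟨?_, fun hv => ?_⟩
      · rintro (rfl | h)
        exacts [hj t ht, h.1]
      · refine or_iff_not_imp_right.2 fun h => ?_
        obtain ⟨s, hs, rfl⟩ := mem_image.1 (show v ∈ Z by tauto)
        by_contra hst
        exact disjoint_left.1 (hdisj hs ht fun h => hst (by rw [h])) (hj s hs) hv
    have hec' (t) (ht : t ∈ T) : #(e t \ Z) = d := by
      have := hec t ht
      rw [← he t ht, card_insert_of_notMem (by simp [hjZ t ht])] at this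
      omega
    have heX' (t) (ht : t ∈ T) : e t \ Z ⊆ X \ Z := sdiff_subset_sdiff (heX t ht) le_rfl
    have hset {z S : Finset V} (hz : z ⊆ Z) (hS : S ⊆ X \ Z) (hSd : d ≤ #S) :
        setOnes a z S = a S + ∑ i ∈ z, a (insert i S) := by
      refine setOnes_eq_add_sum fun B hB hBc => hdeg _
        (union_subset (hS.trans sdiff_subset) (hB.trans (hz.trans hZX))) ?_
      rw [card_union_of_disjoint
        (disjoint_of_subset_left hS (disjoint_of_subset_right (hB.trans hz) sdiff_disjoint))]
      omega
    have hset' {z S : Finset V} (hz : z ⊆ Z) (hS : S ⊆ X \ Z) (hSd : d < #S) :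
        setOnes a z S = a S := by
      rw [hset hz hS hSd.le, sum_eq_zero, add_zero]
      intro i hi
      have hiS : i ∉ S := fun h => (mem_sdiff.1 (hS h)).2 (hz hi)
      refine hdeg _ (insert_subset (hZX (hz hi)) (hS.trans sdiff_subset)) ?_
      rw [card_insert_of_notMem hiS]
      omega
    have hqpow : q ^ 2 ^ (d + 1) ≤ q ^ 2 :=
      pow_le_pow_of_le_one hq0 hq1 (by rw [pow_succ]; linarith [Nat.one_le_two_pow (n := d)])
    set r := (32 * 4 ^ u) ^ d * 2 ^ u with hr
    have hr1 : 2 ^ u ≤ r := Nat.le_mul_of_pos_left _ (by positivity)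
    have hrT : 32 * 4 ^ u * r ≤ #T := by rw [hr, ← mul_assoc, ← pow_succ']; exact hT
    have hinner (z') (hz' : z' ∈ Z.powerset) : ∑ z ∈ Z.powerset,
        (#{x ∈ (X \ Z).powerset | cubeSum (setOnes a z - setOnes a z') x = 0} : ℝ) ≤
          3 * q ^ 2 * 2 ^ #X := by
      rw [mem_powerset] at hz'
      -- The coefficient of the difference at `e t \ Z` is form `A t` at `z` minus `c t`, and `A t
      -- (j t) = a (e t) ≠ 0`.
      set c : ι → ℝ := fun t => ∑ i ∈ z', a (insert i (e t \ Z)) with hc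
      set A : ι → V → ℝ := fun t i => a (insert i (e t \ Z)) with hA
      have hbad := two_pow_mul_card_few_nonzero_le (a := A) hjinj hjZ
        (fun t ht => by rw [hA]; simpa only [he t ht] using hea t ht) c hu hr1 hrT
      set Bad := {z ∈ Z.powerset | #{t ∈ T | ∑ i ∈ z, A t i ≠ c t} < r} with hBad
      have hgood (z) (hz : z ∈ Z.powerset) (hzb : z ∉ Bad) :
          (#{x ∈ (X \ Z).powerset | cubeSum (setOnes a z - setOnes a z') x = 0} : ℝ) ≤
            2 * q ^ 2 * 2 ^ #(X \ Z) := by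
        set T' := {t ∈ T | ∑ i ∈ z, A t i ≠ c t} with hT'
        have hT'T : T' ⊆ T := filter_subset _ _
        have hrT' : r ≤ #T' := by
          by_contra h
          exact hzb (mem_filter.2 ⟨hz, not_le.1 h⟩)
        rw [mem_powerset] at hz
        have hpos : 0 < #T' := lt_of_lt_of_le (by positivity) hrT'
        refine ih (T := T') (e := fun t => e t \ Z) ?_ (fun t ht => heX' t (hT'T ht))
          (fun t ht => hec' t (hT'T ht)) ?_ ?_ hrT' (sq_nonneg q) (pow_le_one₀ hq0 hq1) ?_ hpos
          (card_pos.1 hpos).choose (card_pos.1 hpos).choose_spec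
        · intro S hS hSd
          rw [Pi.sub_apply, hset' hz hS hSd, hset' hz' hS hSd, sub_self]
        · exact fun s hs t ht hst => disjoint_of_subset_left sdiff_subset
            (disjoint_of_subset_right sdiff_subset (hdisj (hT'T hs) (hT'T ht) hst))
        · intro t ht
          rw [Pi.sub_apply, hset hz (heX' t (hT'T ht)) (hec' t (hT'T ht)).ge,
            hset hz' (heX' t (hT'T ht)) (hec' t (hT'T ht)).ge, add_sub_add_left_eq_sub]
          exact sub_ne_zero.2 (mem_filter.1 ht).2
        · rwa [← pow_mul, ← pow_succ']
      have hle (z) (hz : z ∈ Z.powerset) :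
          (#{x ∈ (X \ Z).powerset | cubeSum (setOnes a z - setOnes a z') x = 0} : ℝ) ≤
            2 * q ^ 2 * 2 ^ #(X \ Z) + if z ∈ Bad then 2 ^ #(X \ Z) else 0 := by
        split_ifs with h
        · have : #{x ∈ (X \ Z).powerset | cubeSum (setOnes a z - setOnes a z') x = 0} ≤
              2 ^ #(X \ Z) := (card_filter_le _ _).trans (card_powerset _).le
          have : (#{x ∈ (X \ Z).powerset | cubeSum (setOnes a z - setOnes a z') x = 0} : ℝ) ≤
              2 ^ #(X \ Z) := mod_cast this
          have : 0 ≤ 2 * q ^ 2 * 2 ^ #(X \ Z) := by positivity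
          linarith
        · rw [add_zero]
          exact hgood z hz h
      have hbad' : (#Bad : ℝ) ≤ q ^ 2 * 2 ^ #Z := by
        have h1 : (2 ^ u * #Bad : ℝ) ≤ 2 * 2 ^ #Z := mod_cast hbad
        calc (#Bad : ℝ) ≤ 2 / 2 ^ u * 2 ^ #Z := by
              rw [div_mul_eq_mul_div, le_div_iff₀' (by positivity)]
              exact h1
          _ ≤ q ^ 2 * 2 ^ #Z := by gcongr; exact hq.trans hqpow
      -- Good `z` contribute `2 * q ^ 2` by induction, bad ones `q ^ 2`; the total `3 * q ^ 2` is
      -- below `(2 * q) ^ 2`.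
      refine (sum_le_sum hle).trans ?_
      rw [sum_add_distrib, sum_ite_mem, inter_eq_right.2 (filter_subset _ _), sum_const, sum_const,
        nsmul_eq_mul, nsmul_eq_mul, card_powerset, hcard, pow_add]
      push_cast
      nlinarith [mul_le_mul_of_nonneg_right hbad' (by positivity : (0 : ℝ) ≤ 2 ^ #(X \ Z))]
    have hsq := sq_card_cubeSum_eq_zero_le a (X := X \ Z) (Z := Z) sdiff_disjoint
    rw [← hXZ] at hsq
    have hsq' : (#{w ∈ X.powerset | cubeSum a w = 0} : ℝ) ^ 2 ≤ 2 ^ #(X \ Z) * ∑ z' ∈ Z.powerset,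
      ∑ z ∈ Z.powerset, (#{x ∈ (X \ Z).powerset |
        cubeSum (setOnes a z - setOnes a z') x = 0} : ℝ) := mod_cast hsq
    have hsum := sum_le_card_nsmul _ _ _ hinner
    refine (sq_le_sq₀ (Nat.cast_nonneg _) (by positivity)).1 ?_
    refine hsq'.trans ((mul_le_mul_of_nonneg_left hsum (by positivity)).trans ?_)
    rw [nsmul_eq_mul, card_powerset]
    push_cast
    calc (2 : ℝ) ^ #(X \ Z) * (2 ^ #Z * (3 * q ^ 2 * 2 ^ #X))
        = 3 * (q * 2 ^ #X) ^ 2 := by rw [hcard, pow_add]; ring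
      _ ≤ (2 * q * 2 ^ #X) ^ 2 := by nlinarith [sq_nonneg (q * 2 ^ #X)]

/-! ### Agreement with parity -/

open Finset in
-- Flipping one coordinate maps agreement injectively into disagreement. The shift `k` counts the
-- ones among variables already fixed.
theorem two_mul_card_const_eq_parity_le {V : Type*} [DecidableEq V] {X : Finset V}
    (hX : X.Nonempty) (c : ℝ) (k : ℕ) :
    2 * #{x ∈ X.powerset | c = if Odd (#x + k) then 1 else 0} ≤ 2 ^ #X := by
  obtain ⟨i, hi⟩ := hX
  have hodd (x : Finset V) : Odd (#(symmDiff x {i}) + k) ↔ ¬ Odd (#x + k) := by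
    by_cases h : i ∈ x
    · have : symmDiff x {i} = x.erase i := by
        ext v
        by_cases hv : v = i <;> simp [mem_symmDiff, hv, h]
      rw [this, ← card_erase_add_one h, add_right_comm, Nat.odd_add_one, not_not]
    · have : symmDiff x {i} = insert i x := by
        ext v
        by_cases hv : v = i <;> simp [mem_symmDiff, hv, h]
      rw [this, card_insert_of_notMem h, add_right_comm, Nat.odd_add_one]
  have h1 : #{x ∈ X.powerset | c = if Odd (#x + k) then 1 else 0} ≤
      #{x ∈ X.powerset | ¬ c = if Odd (#x + k) then 1 else 0} := by
    refine card_le_card_of_injOn (fun x => symmDiff x {i}) ?_ (symmDiff_left_injective _).injOn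
    intro x hx
    simp only [coe_filter, mem_powerset, Set.mem_ofPred_eq] at hx ⊢
    refine ⟨?_, ?_⟩
    · rw [symmDiff_def]
      exact union_subset (sdiff_subset.trans hx.1)
        (sdiff_subset.trans (singleton_subset_iff.2 hi))
    · simp only [hx.2, hodd]
      split_ifs <;> simp
  have h2 := card_filter_add_card_filter_not (s := X.powerset)
    fun x => c = if Odd (#x + k) then (1 : ℝ) else 0
  rw [card_powerset] at h2
  omega

theorem cubeSum_sub_single {V : Type*} [DecidableEq V] (a : Finset V → ℝ) (c : ℝ)
    (x : Finset V) : cubeSum (a - Pi.single ∅ c) x = cubeSum a x - c := by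
  rw [cubeSum_sub]
  congr 1
  rw [cubeSum, Finset.sum_eq_single ∅]
  · simp
  · intro S _ hS
    simp [hS]
  · simp

open Finset in
/-- A maximal family of disjoint sets satisfying `P`. -/
theorem exists_maximal_disjoint_family {V : Type*} [DecidableEq V] (X : Finset V)
    (P : Finset V → Prop) : ∃ F : Finset (Finset V), (∀ S ∈ F, S ⊆ X ∧ P S) ∧
      (F : Set (Finset V)).PairwiseDisjoint id ∧
      ∀ S ⊆ X, S.Nonempty → P S → ¬ Disjoint S (F.biUnion id) := by
  classical
  obtain ⟨F, hF, hmax⟩ := exists_max_image (X.powerset.powerset.filter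
    fun F : Finset (Finset V) => (∀ S ∈ F, P S) ∧ (F : Set (Finset V)).PairwiseDisjoint id) card
    ⟨∅, by simp⟩
  rw [mem_filter, mem_powerset] at hF
  refine ⟨F, fun S hS => ⟨mem_powerset.1 (hF.1 hS), hF.2.1 S hS⟩, hF.2.2, ?_⟩
  intro S hSX hne hP hdisj
  rw [disjoint_biUnion_right] at hdisj
  have hSF : S ∉ F := fun h => hne.ne_empty (disjoint_self.1 (hdisj S h))
  have := hmax (insert S F) (by
    rw [mem_filter, mem_powerset]
    refine ⟨insert_subset (mem_powerset.2 hSX) hF.1, ?_, ?_⟩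
    · intro S' hS'
      rcases mem_insert.1 hS' with rfl | h
      exacts [hP, hF.2.1 _ h]
    · rw [coe_insert]
      exact hF.2.2.insert fun S' hS' _ => hdisj S' hS')
  rw [card_insert_of_notMem hSF] at this
  omega

open Finset in
-- The dichotomy. Each round fixes at most `M` variables and there are at most `d` rounds, so `d * M
-- < #X` leaves one free.
theorem two_mul_card_cubeSum_eq_parity_le {V : Type*} [DecidableEq V] {u D M : ℕ} (hu : 1 ≤ u)
    (huD : (2 : ℝ) / 2 ^ u ≤ (1 / 8) ^ 2 ^ D) (hM : D * ((32 * 4 ^ u) ^ D * 2 ^ u) ≤ M)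
    {d : ℕ} (hd : d ≤ D) {X : Finset V} {a : Finset V → ℝ} (k : ℕ)
    (hdeg : ∀ S ⊆ X, d < #S → a S = 0) (hX : d * M < #X) :
    2 * #{x ∈ X.powerset | cubeSum a x = if Odd (#x + k) then 1 else 0} ≤ 2 ^ #X := by
  induction d generalizing X a k with
  | zero =>
    have hconst : ∀ x ∈ X.powerset, cubeSum a x = a ∅ := fun x hx =>
      sum_eq_single ∅ (fun S hS hS0 => hdeg S ((mem_powerset.1 hS).trans (mem_powerset.1 hx))
        (card_pos.2 (nonempty_iff_ne_empty.2 hS0))) (by simp)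
    rw [filter_congr fun x hx => by rw [hconst x hx]]
    exact two_mul_card_const_eq_parity_le (card_pos.1 (by omega)) _ k
  | succ d ih =>
    obtain ⟨F, hFX, hFdisj, hFmax⟩ :=
      exists_maximal_disjoint_family X fun S => #S = d + 1 ∧ a S ≠ 0
    by_cases hF : (32 * 4 ^ u) ^ (d + 1) * 2 ^ u ≤ #F
    · have hq : (2 : ℝ) / 2 ^ u ≤ (1 / 8) ^ 2 ^ (d + 1) :=
        huD.trans (pow_le_pow_of_le_one (by norm_num) (by norm_num)
          (Nat.pow_le_pow_right two_pos hd))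
      -- With `q = 1 / 8` each of the values 0 and 1 has proportion at most `1 / 4`.
      have h0 := card_cubeSum_eq_zero_le hu (d + 1) hdeg (fun S hS => (hFX S hS).1)
        (fun S hS => (hFX S hS).2.1) hFdisj (fun S hS => (hFX S hS).2.2) hF
        (by norm_num) (by norm_num) hq
      have hsub (S : Finset V) (hS : d + 1 ≤ #S) :
          (a - (Pi.single ∅ 1 : Finset V → ℝ)) S = a S := by
        have : S ≠ ∅ := nonempty_iff_ne_empty.1 (card_pos.1 (by omega))
        simp [this]
      have h1 := card_cubeSum_eq_zero_le hu (d + 1) (a := a - (Pi.single ∅ 1 : Finset V → ℝ))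
        (fun S hS hSd => by rw [hsub S hSd.le, hdeg S hS hSd]) (fun S hS => (hFX S hS).1)
        (fun S hS => (hFX S hS).2.1) hFdisj
        (fun S hS => by rw [hsub S (hFX S hS).2.1.ge]; exact (hFX S hS).2.2) hF
        (by norm_num) (by norm_num) hq
      have hle : #{x ∈ X.powerset | cubeSum a x = if Odd (#x + k) then 1 else 0} ≤
          #{x ∈ X.powerset | cubeSum a x = 0} +
            #{x ∈ X.powerset | cubeSum (a - (Pi.single ∅ 1 : Finset V → ℝ)) x = 0} := by
        refine (card_le_card fun x hx => ?_).trans (card_union_le _ _)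
        rw [mem_filter] at hx
        rw [mem_union, mem_filter, mem_filter, cubeSum_sub_single, hx.2]
        split_ifs <;> simp [hx.1]
      have hle' : (#{x ∈ X.powerset | cubeSum a x = if Odd (#x + k) then 1 else 0} : ℝ) ≤
          #{x ∈ X.powerset | cubeSum a x = 0} +
            #{x ∈ X.powerset | cubeSum (a - (Pi.single ∅ 1 : Finset V → ℝ)) x = 0} :=
        mod_cast hle
      have : (2 * #{x ∈ X.powerset | cubeSum a x = if Odd (#x + k) then 1 else 0} : ℝ) ≤
          2 ^ #X := by linarith
      exact_mod_cast this
    · set W := F.biUnion id with hW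
      have hWX : W ⊆ X := biUnion_subset.2 fun S hS => (hFX S hS).1
      have hWM : #W ≤ M := by
        refine (card_biUnion_le_card_mul F id (d + 1) fun S hS => (hFX S hS).2.1.le).trans ?_
        refine le_trans ?_ hM
        rw [mul_comm]
        refine Nat.mul_le_mul hd ((not_le.1 hF).le.trans (Nat.mul_le_mul_right _ ?_))
        exact Nat.pow_le_pow_right (by positivity) hd
      have hXW : X = W ∪ X \ W := (union_sdiff_of_subset hWX).symm
      have hcard : #X = #W + #(X \ W) := by rw [add_comm, card_sdiff_add_card_eq_card hWX]
      have hcount : #{x ∈ X.powerset | cubeSum a x = if Odd (#x + k) then 1 else 0} =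
          ∑ w ∈ W.powerset, #{z ∈ (X \ W).powerset |
            cubeSum a (w ∪ z) = if Odd (#(w ∪ z) + k) then 1 else 0} := by
        have h := card_filter_powerset_disjUnion (disjoint_sdiff (s := W) (t := X))
          fun x => cubeSum a x = if Odd (#x + k) then 1 else 0
        rwa [← hXW] at h
      rw [hcount, hcard, pow_add, ← card_powerset W, ← smul_eq_mul (#(powerset _)), mul_sum]
      refine sum_le_card_nsmul _ _ _ fun w hw => ?_
      rw [mem_powerset] at hw
      have hdw {z : Finset V} (hz : z ⊆ X \ W) : Disjoint z w :=
        disjoint_of_subset_left hz (disjoint_of_subset_right hw sdiff_disjoint)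
      have hfil : ∀ z ∈ (X \ W).powerset,
          (cubeSum a (w ∪ z) = if Odd (#(w ∪ z) + k) then 1 else 0) ↔
            cubeSum (setOnes a w) z = if Odd (#z + (#w + k)) then 1 else 0 := by
        intro z hz
        have hd := hdw (mem_powerset.1 hz)
        rw [union_comm, cubeSum_union a hd, card_union_of_disjoint hd, add_assoc]
      rw [filter_congr hfil]
      refine ih (by omega) _ ?_ (by rw [add_mul] at hX; omega)
      intro S hS hSd
      have hSX := hS.trans sdiff_subset
      refine sum_eq_zero fun B hB => ?_
      rw [mem_powerset] at hB
      have hSB : S ∪ B ⊆ X := union_subset hSX (hB.trans (hw.trans hWX))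
      have hSBc := card_union_of_disjoint (disjoint_of_subset_right hB (hdw hS))
      -- In the second case `S` is a degree-`d + 1` monomial disjoint from `W`, which maximality of
      -- `F` excludes.
      rcases (show d + 1 < #(S ∪ B) ∨ #B = 0 ∧ #S = d + 1 by omega) with h | ⟨h0, h1⟩
      · exact hdeg _ hSB h
      · rw [card_eq_zero.1 h0, union_empty]
        by_contra ha
        exact hFmax S hSX (card_pos.1 (by omega)) ⟨h1, ha⟩
          (disjoint_of_subset_left hS sdiff_disjoint)

/-! ### From polynomials to multilinear coefficients -/

/-- The coefficients of the multilinear polynomial that agrees with `p` on the cube. -/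
noncomputable def multilinearCoeff {n : ℕ} (p : MvPolynomial (Fin n) ℝ) (S : Finset (Fin n)) : ℝ :=
  ∑ m ∈ p.support with m.support = S, p.coeff m

theorem polyOnCube_eq_cubeSum {n : ℕ} (p : MvPolynomial (Fin n) ℝ) (x : Fin n → Bool) :
    polyOnCube p x = cubeSum (multilinearCoeff p) (Finset.univ.filter fun i => x i = true) := by
  classical
  rw [polyOnCube, MvPolynomial.eval_eq, cubeSum]
  simp only [multilinearCoeff, Finset.sum_filter]
  rw [Finset.sum_comm]
  refine Finset.sum_congr rfl fun m _ => ?_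
  rw [Finset.sum_ite_eq]
  split_ifs with h
  · rw [Finset.prod_eq_one, mul_one]
    intro i hi
    have := Finset.mem_powerset.1 h hi
    simp_all [cubePoint]
  · rw [Finset.mem_powerset, Finset.not_subset] at h
    obtain ⟨i, hi, hix⟩ := h
    rw [Finset.prod_eq_zero hi, mul_zero]
    simp_all [cubePoint]

theorem multilinearCoeff_eq_zero {n : ℕ} {p : MvPolynomial (Fin n) ℝ} {S : Finset (Fin n)}
    (h : p.totalDegree < S.card) : multilinearCoeff p S = 0 := by
  refine Finset.sum_eq_zero fun m hm => absurd ?_ (not_le.2 h)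
  rw [Finset.mem_filter] at hm
  refine le_trans ?_ (MvPolynomial.le_totalDegree hm.1)
  rw [← hm.2, Finset.card_eq_sum_ones]
  exact Finset.sum_le_sum fun i hi => Nat.one_le_iff_ne_zero.2 (Finsupp.mem_support_iff.1 hi)

open Finset in
theorem cor_polyOnCube_parity_eq {n : ℕ} (p : MvPolynomial (Fin n) ℝ) :
    cor n (polyOnCube p) (parity n) = (#{x ∈ (univ : Finset (Fin n)).powerset |
      cubeSum (multilinearCoeff p) x = if Odd (#x + 0) then 1 else 0} : ℝ) / 2 ^ n - 1 / 2 := by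
  rw [cor_eq_card]
  congr 3
  refine card_nbij' (fun x => univ.filter fun i => x i = true) (fun S i => decide (i ∈ S)) ?_ ?_
    ?_ ?_
  · intro x hx
    have hx := (mem_filter.1 (mem_coe.1 hx)).2
    rw [polyOnCube_eq_cubeSum, parity] at hx
    simpa using hx
  · intro S hS
    have hS := (mem_filter.1 (mem_coe.1 hS)).2
    simpa [polyOnCube_eq_cubeSum, parity] using hS
  · intro x _
    ext i
    simp
  · intro S _
    ext i
    simp

/-! ### Choice of parameters and conclusion -/

/-- The exponent on the left is about `6 * D * 2 ^ D`, below `4 ^ D` once `6 * D + 5 ≤ 2 ^ D`, which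
holds from `D = 6` on. -/
theorem degree_mul_lt_two_pow {D : ℕ} (hD : 6 ≤ D) :
    D * (D * ((32 * 4 ^ (3 * 2 ^ D + 1)) ^ D * 2 ^ (3 * 2 ^ D + 1))) < 2 ^ 4 ^ D := by
  have hN : 6 * D + 5 ≤ 2 ^ D := by
    induction D, hD using Nat.le_induction with
    | base => norm_num
    | succ D hD ih => rw [pow_succ]; omega
  have hexp : (5 + 2 * (3 * 2 ^ D + 1)) * D + (3 * 2 ^ D + 1) + 2 * D ≤ 4 ^ D := by
    rw [show 4 ^ D = 2 ^ D * 2 ^ D by rw [← mul_pow]; norm_num]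
    nlinarith
  have hu (u : ℕ) : (32 * 4 ^ u) ^ D * 2 ^ u = 2 ^ ((5 + 2 * u) * D + u) := by
    rw [show (32 : ℕ) = 2 ^ 5 by norm_num, show (4 : ℕ) = 2 ^ 2 by norm_num, ← pow_mul, ← pow_add,
      ← pow_mul, ← pow_add]
  rw [hu]
  refine lt_of_lt_of_le ?_ (Nat.pow_le_pow_right two_pos hexp)
  have hlt : D < 2 ^ D := Nat.lt_two_pow_self
  rw [← mul_assoc, pow_add 2 _ (2 * D), two_mul D, pow_add 2 D, mul_comm]
  exact Nat.mul_lt_mul_of_pos_left (Nat.mul_lt_mul'' hlt hlt) (by positivity)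

theorem two_pow_four_pow_le_of_le_logb {n k : ℕ} (hn : 2 ≤ n)
    (h : (k : ℝ) ≤ Real.logb 2 (Real.logb 2 (n : ℝ)) / 2) : 2 ^ 4 ^ k ≤ n := by
  have hn' : (2 : ℝ) ≤ n := mod_cast hn
  have hlog : 0 < Real.logb 2 (n : ℝ) := Real.logb_pos (by norm_num) (by linarith)
  have h1 : ((2 * k : ℕ) : ℝ) ≤ Real.logb 2 (Real.logb 2 (n : ℝ)) := by push_cast; linarith
  rw [Real.le_logb_iff_rpow_le (by norm_num) hlog, Real.rpow_natCast, pow_mul] at h1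
  have h2 : ((4 ^ k : ℕ) : ℝ) ≤ Real.logb 2 (n : ℝ) := by
    push_cast
    norm_num at h1
    exact h1
  rw [Real.le_logb_iff_rpow_le (by norm_num) (by linarith), Real.rpow_natCast] at h2
  exact_mod_cast h2

theorem mainTheorem11 :
    ∃ n₀ : ℕ, ∀ n : ℕ, n₀ ≤ n → ∀ p : MvPolynomial (Fin n) ℝ,
      (p.totalDegree : ℝ) ≤ Real.logb 2 (Real.logb 2 (n : ℝ)) / 2 →
        cor n (polyOnCube p) (parity n) ≤ 0 := by
  refine ⟨2 ^ 4 ^ 6, fun n hn p hp => ?_⟩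
  have hn2 : 2 ≤ n := le_trans (Nat.le_self_pow (by positivity) 2) hn
  obtain ⟨D, hD6, hpD, hDn⟩ : ∃ D, 6 ≤ D ∧ p.totalDegree ≤ D ∧ 2 ^ 4 ^ D ≤ n := by
    rcases le_total p.totalDegree 6 with h | h
    · exact ⟨6, le_rfl, h, hn⟩
    · exact ⟨_, h, le_rfl, two_pow_four_pow_le_of_le_logb hn2 hp⟩
  -- The choice `u = 3 * 2 ^ D + 1` makes this an equality.
  have hu : (2 : ℝ) / 2 ^ (3 * 2 ^ D + 1) ≤ (1 / 8) ^ 2 ^ D := by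
    rw [pow_succ, pow_mul, div_pow, one_pow]
    norm_num
    field_simp
    exact le_rfl
  have hcount := two_mul_card_cubeSum_eq_parity_le (X := (Finset.univ : Finset (Fin n)))
    (a := multilinearCoeff p) (by omega) hu le_rfl le_rfl 0
    (fun S _ hS => multilinearCoeff_eq_zero (hpD.trans_lt hS))
    (by rw [Finset.card_univ, Fintype.card_fin]; exact (degree_mul_lt_two_pow hD6).trans_le hDn)
  rw [Finset.card_univ, Fintype.card_fin] at hcount
  rw [cor_polyOnCube_parity_eq, sub_nonpos, div_le_div_iff₀ (by positivity) two_pos, mul_comm,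
    one_mul]
  exact_mod_cast hcount
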